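/- For $A\subseteq\mathbb{R}$ let $\tau_A$ be the topology on $\mathbb{R}$ in which the intervals $(x-\varepsilon,x+\varepsilon)$, $\varepsilon>0$, form a neighbourhood base at each $x\in A$, and the intervals $[x,x+\varepsilon)$, $\varepsilon>0$, form a neighbourhood base at each $x\in\mathbb{R}\setminus A$. A topological space $(X,\tau)$ is a $\beta$-space if there is a function $g:\mathbb{N}\times X\to\tau$ (with $\mathbb{N}=\{0,1,2,\dots\}$) such that $x\in g(n,x)$ for all $n\in\mathbb{N}$ and $x\in X$, and such that, whenever $x\in X$ and a sequence $(x_n)_{n\in\mathbb{N}}$ in $X$ satisfy $x\in g(n,x_n)$ for all $n\in\mathbb{N}$, the sequence $(x_n)$ has a cluster point in $X$. Then, for every $A\subseteq\mathbb{R}$, the following are equivalent: 1. $(\mathbb{R},\tau_A)$ is metrizable; 2. $(\mathbb{R},\tau_A)$ is a $\beta$-space; 3. $\mathbb{R}\setminus A$ is countable (finite or countably infinite). -/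

import Mathlib

/-- The topology `τ_A` on `ℝ`: at the points of `A` the intervals `(x - ε, x + ε)` are the basic
neighbourhoods, at the points outside `A` the intervals `[x, x + ε)`. -/
abbrev hTopology (A : Set ℝ) : TopologicalSpace ℝ where
  IsOpen U := ∀ x ∈ U,
    (x ∈ A → ∃ ε > 0, Set.Ioo (x - ε) (x + ε) ⊆ U) ∧ (x ∉ A → ∃ ε > 0, Set.Ico x (x + ε) ⊆ U)
  isOpen_univ := fun _ _ =>
    ⟨fun _ => ⟨1, one_pos, Set.subset_univ _⟩, fun _ => ⟨1, one_pos, Set.subset_univ _⟩⟩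
  isOpen_inter := by
    rintro U V hU hV x ⟨hxU, hxV⟩
    refine ⟨fun hx => ?_, fun hx => ?_⟩
    · obtain ⟨ε, hε, h⟩ := (hU x hxU).1 hx
      obtain ⟨δ, hδ, h'⟩ := (hV x hxV).1 hx
      refine ⟨min ε δ, lt_min hε hδ, Set.subset_inter (subset_trans ?_ h) (subset_trans ?_ h')⟩
      · exact Set.Ioo_subset_Ioo (by linarith [min_le_left ε δ]) (by linarith [min_le_left ε δ])
      · exact Set.Ioo_subset_Ioo (by linarith [min_le_right ε δ]) (by linarith [min_le_right ε δ])
    · obtain ⟨ε, hε, h⟩ := (hU x hxU).2 hx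
      obtain ⟨δ, hδ, h'⟩ := (hV x hxV).2 hx
      refine ⟨min ε δ, lt_min hε hδ, Set.subset_inter (subset_trans ?_ h) (subset_trans ?_ h')⟩
      · exact Set.Ico_subset_Ico le_rfl (by linarith [min_le_left ε δ])
      · exact Set.Ico_subset_Ico le_rfl (by linarith [min_le_right ε δ])
  isOpen_sUnion := by
    rintro S hS x ⟨U, hU, hxU⟩
    refine ⟨fun hx => ?_, fun hx => ?_⟩
    · obtain ⟨ε, hε, h⟩ := (hS U hU x hxU).1 hx
      exact ⟨ε, hε, h.trans (Set.subset_sUnion_of_mem hU)⟩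
    · obtain ⟨ε, hε, h⟩ := (hS U hU x hxU).2 hx
      exact ⟨ε, hε, h.trans (Set.subset_sUnion_of_mem hU)⟩

theorem isOpen_hTopology_Ioo (A : Set ℝ) (a b : ℝ) : @IsOpen ℝ (hTopology A) (Set.Ioo a b) := by
  rintro x ⟨hax, hxb⟩
  refine ⟨fun _ => ⟨min (x - a) (b - x), lt_min (by linarith) (by linarith), ?_⟩,
    fun _ => ⟨b - x, by linarith, fun y hy => ⟨by linarith [hy.1], by linarith [hy.2]⟩⟩⟩
  exact Set.Ioo_subset_Ioo (by linarith [min_le_left (x - a) (b - x)])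
    (by linarith [min_le_right (x - a) (b - x)])

theorem isOpen_hTopology_Ico {A : Set ℝ} {a : ℝ} (ha : a ∉ A) (b : ℝ) :
    @IsOpen ℝ (hTopology A) (Set.Ico a b) := by
  rintro x ⟨hax, hxb⟩
  refine ⟨fun hx => ?_, fun _ => ⟨b - x, by linarith, fun y hy =>
    ⟨by linarith [hy.1], by linarith [hy.2]⟩⟩⟩
  have hlt : a < x := lt_of_le_of_ne hax (by rintro rfl; exact ha hx)
  obtain ⟨ε, hε, h⟩ := (isOpen_hTopology_Ioo A a b x ⟨hlt, hxb⟩).1 hx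
  exact ⟨ε, hε, h.trans Set.Ioo_subset_Ico_self⟩

theorem nhds_hTopology_of_mem {A : Set ℝ} {x : ℝ} (hx : x ∈ A) :
    (@nhds ℝ (hTopology A) x).HasBasis (fun ε : ℝ => 0 < ε) fun ε => Set.Ioo (x - ε) (x + ε) := by
  let _ : TopologicalSpace ℝ := hTopology A
  refine ⟨fun t => ⟨fun ht => ?_, ?_⟩⟩
  · obtain ⟨U, hUt, hU, hxU⟩ := mem_nhds_iff.1 ht
    obtain ⟨ε, hε, h⟩ := (hU x hxU).1 hx
    exact ⟨ε, hε, h.trans hUt⟩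
  · rintro ⟨ε, hε, h⟩
    exact mem_nhds_iff.2 ⟨_, h, isOpen_hTopology_Ioo A _ _, by linarith, by linarith⟩

theorem nhds_hTopology_of_notMem {A : Set ℝ} {x : ℝ} (hx : x ∉ A) :
    (@nhds ℝ (hTopology A) x).HasBasis (fun ε : ℝ => 0 < ε) fun ε => Set.Ico x (x + ε) := by
  let _ : TopologicalSpace ℝ := hTopology A
  refine ⟨fun t => ⟨fun ht => ?_, ?_⟩⟩
  · obtain ⟨U, hUt, hU, hxU⟩ := mem_nhds_iff.1 ht
    obtain ⟨ε, hε, h⟩ := (hU x hxU).2 hx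
    exact ⟨ε, hε, h.trans hUt⟩
  · rintro ⟨ε, hε, h⟩
    exact mem_nhds_iff.2 ⟨_, h, isOpen_hTopology_Ico hx _, le_rfl, by linarith⟩

/-- `(X, τ)` is a `β`-space: there are open neighbourhoods `g n x` of each point `x` such that
every sequence `u` for which some point `x` lies in all the sets `g n (u n)` has a cluster
point. -/
def IsBetaSpace (X : Type*) (τ : TopologicalSpace X) : Prop :=
  ∃ g : ℕ → X → Set X, (∀ n x, @IsOpen X τ (g n x)) ∧ (∀ n x, x ∈ g n x) ∧
    ∀ (x : X) (u : ℕ → X), (∀ n, x ∈ g n (u n)) → ∃ y : X, @MapClusterPt X τ ℕ y Filter.atTop u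

/-! If `Aᶜ` is countable, Urysohn's metrization theorem applies: only the points of `Aᶜ` need
themselves as left endpoints of basic sets. Conversely, let `g` witness the β-property and `x ∉ A`.
Points `u n < x` tending to `x` with `x ∈ g n (u n)` for all `n` would need a cluster point, which
could only be `x`, yet `[x, x + 1)` misses them all. So some `n` bars `x` from `g n u` for all `u`
just left of `x`; for each `n`, such `x` are isolated on the right among themselves, hence countably
many. -/

theorem hTopology_le (A : Set ℝ) :
    hTopology A ≤ (inferInstance : TopologicalSpace ℝ) := by
  intro U hU x hx
  obtain ⟨ε, hε, h⟩ := Metric.isOpen_iff.1 hU x hx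
  rw [Real.ball_eq_Ioo] at h
  exact ⟨fun _ => ⟨ε, hε, h⟩, fun _ => ⟨ε, hε, fun y hy => h ⟨by linarith [hy.1], hy.2⟩⟩⟩

/-- The usual topology on `ℝ` is coarser, so a closed interval is closed for `hTopology A`. -/
theorem isClosed_hTopology_Icc (A : Set ℝ) (a b : ℝ) :
    @IsClosed ℝ (hTopology A) (Set.Icc a b) :=
  isClosed_Icc.mono (hTopology_le A)

theorem t2Space_hTopology (A : Set ℝ) : @T2Space ℝ (hTopology A) :=
  t2Space_antitone (hTopology_le A) inferInstance

theorem regularSpace_hTopology (A : Set ℝ) : @RegularSpace ℝ (hTopology A) := by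
  refine @RegularSpace.of_exists_mem_nhds_isClosed_subset ℝ (hTopology A) fun x s hs => ?_
  by_cases hx : x ∈ A
  · obtain ⟨ε, hε, h⟩ := (nhds_hTopology_of_mem hx).mem_iff.1 hs
    refine ⟨Set.Icc (x - ε / 2) (x + ε / 2),
      (nhds_hTopology_of_mem hx).mem_iff.2 ⟨ε / 2, half_pos hε, Set.Ioo_subset_Icc_self⟩,
      isClosed_hTopology_Icc A _ _, fun y hy => h ⟨?_, ?_⟩⟩ <;> linarith [hy.1, hy.2]
  · obtain ⟨ε, hε, h⟩ := (nhds_hTopology_of_notMem hx).mem_iff.1 hs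
    refine ⟨Set.Icc x (x + ε / 2),
      (nhds_hTopology_of_notMem hx).mem_iff.2 ⟨ε / 2, half_pos hε, Set.Ico_subset_Icc_self⟩,
      isClosed_hTopology_Icc A _ _, fun y hy => h ⟨hy.1, ?_⟩⟩
    linarith [hy.2]

theorem secondCountableTopology_hTopology {A : Set ℝ} (hA : Aᶜ.Countable) :
    @SecondCountableTopology ℝ (hTopology A) := by
  let _ : TopologicalSpace ℝ := hTopology A
  let B : Set (Set ℝ) := (Set.range fun p : ℚ × ℚ => Set.Ioo (p.1 : ℝ) p.2) ∪
    ⋃ a ∈ Aᶜ, Set.range fun q : ℚ => Set.Ico a (q : ℝ)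
  have hB : B.Countable :=
    (Set.countable_range _).union (hA.biUnion fun _ _ => Set.countable_range _)
  refine (TopologicalSpace.isTopologicalBasis_of_isOpen_of_nhds (s := B)
    ?_ ?_).secondCountableTopology hB
  · rintro U (⟨p, rfl⟩ | hU)
    · exact isOpen_hTopology_Ioo A _ _
    · obtain ⟨a, ha, q, rfl⟩ := Set.mem_iUnion₂.1 hU
      exact isOpen_hTopology_Ico ha _
  · intro x U hxU hU
    by_cases hx : x ∈ A
    · obtain ⟨ε, hε, h⟩ := (hU x hxU).1 hx
      obtain ⟨p, hp, hpx⟩ := exists_rat_btwn (sub_lt_self x hε)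
      obtain ⟨q, hxq, hq⟩ := exists_rat_btwn (lt_add_of_pos_right x hε)
      exact ⟨_, .inl ⟨(p, q), rfl⟩, ⟨hpx, hxq⟩, (Set.Ioo_subset_Ioo hp.le hq.le).trans h⟩
    · obtain ⟨ε, hε, h⟩ := (hU x hxU).2 hx
      obtain ⟨q, hxq, hq⟩ := exists_rat_btwn (lt_add_of_pos_right x hε)
      exact ⟨_, .inr (Set.mem_iUnion₂.2 ⟨x, hx, q, rfl⟩), ⟨le_rfl, hxq⟩,
        (Set.Ico_subset_Ico_right hq.le).trans h⟩

theorem isBetaSpace_of_metrizableSpace {X : Type*} (τ : TopologicalSpace X)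
    [TopologicalSpace.MetrizableSpace X] : IsBetaSpace X τ := by
  let _ := TopologicalSpace.metrizableSpaceMetric X
  refine ⟨fun n x => Metric.ball x (1 / ((n : ℝ) + 1)), fun n x => Metric.isOpen_ball,
    fun n x => Metric.mem_ball_self Nat.one_div_pos_of_nat, fun x u hu => ⟨x, ?_⟩⟩
  refine Filter.Tendsto.mapClusterPt (tendsto_iff_dist_tendsto_zero.2 ?_)
  exact squeeze_zero (fun _ => dist_nonneg)
    (fun n => (dist_comm (u n) x).trans_le (Metric.mem_ball.1 (hu n)).le)
    tendsto_one_div_add_atTop_nhds_zero_nat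

/-- A sequence that converges to a point outside `A` strictly from the left has no cluster
point. -/
theorem not_mapClusterPt_hTopology_of_lt {A : Set ℝ} {x : ℝ} (hx : x ∉ A) {u : ℕ → ℝ}
    (hu : Filter.Tendsto u Filter.atTop (nhds x)) (hlt : ∀ n, u n < x) (y : ℝ) :
    ¬ @MapClusterPt ℝ (hTopology A) ℕ y Filter.atTop u := by
  intro h
  -- A cluster point for the finer topology is a Euclidean one, so it equals the limit.
  obtain rfl : y = x := eq_of_nhds_neBot <|
    Filter.NeBot.mono (f := @nhds ℝ (hTopology A) y ⊓ Filter.map u Filter.atTop) h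
      (inf_le_inf (nhds_mono (hTopology_le A)) hu)
  have hmem : Set.Ico y (y + 1) ∈ @nhds ℝ (hTopology A) y :=
    (nhds_hTopology_of_notMem hx).mem_of_mem one_pos
  obtain ⟨n, hn⟩ := ((@mapClusterPt_iff_frequently ℝ (hTopology A) _ _ _ _).1 h _ hmem).exists
  exact (hlt n).not_ge hn.1

theorem countable_compl_of_isBetaSpace {A : Set ℝ} (h : IsBetaSpace ℝ (hTopology A)) :
    Aᶜ.Countable := by
  obtain ⟨g, hgo, hgm, hg⟩ := h
  let S : ℕ → Set ℝ := fun n => {x ∈ Aᶜ | ∀ u ∈ Set.Ioo (x - 1 / ((n : ℝ) + 1)) x, x ∉ g n u}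
  have hS : ∀ n, (S n).Countable := by
    intro n
    have hgap : ∀ x ∈ S n, ∃ z > x, ∀ y ∈ S n, x < y → z ≤ y := by
      intro x hx
      obtain ⟨ε, hε, hsub⟩ := (hgo n x x (hgm n x)).2 hx.1
      have hn : 0 < 1 / ((n : ℝ) + 1) := Nat.one_div_pos_of_nat
      refine ⟨x + min ε (1 / ((n : ℝ) + 1)), lt_add_of_pos_right x (lt_min hε hn),
        fun y hy hxy => ?_⟩
      by_contra! hlt
      have h₁ := min_le_left ε (1 / ((n : ℝ) + 1))
      have h₂ := min_le_right ε (1 / ((n : ℝ) + 1))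
      -- Here `x` plays the role of `u` for `y`: it is within `1 / (n + 1)` to the left of `y`,
      -- while `y ∈ [x, x + ε) ⊆ g n x`.
      exact hy.2 x ⟨by linarith, hxy⟩ (hsub ⟨hxy.le, by linarith⟩)
    choose! z hz hgap using hgap
    -- The gaps `(x, z x)` are disjoint and nonempty.
    refine Set.PairwiseDisjoint.countable_of_Ioo (y := z) ?_ hz
    intro x hx y hy hne
    refine Set.disjoint_left.2 fun t ht ht' => ?_
    rcases hne.lt_or_gt with hxy | hxy
    · exact absurd (hgap x hx y hy hxy) (by linarith [ht.2, ht'.1])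
    · exact absurd (hgap y hy x hx hxy) (by linarith [ht'.2, ht.1])
  refine (Set.countable_iUnion hS).mono fun x hx => ?_
  by_contra hxS
  have hu : ∀ n : ℕ, ∃ u ∈ Set.Ioo (x - 1 / ((n : ℝ) + 1)) x, x ∈ g n u := by
    intro n
    by_contra! hn
    exact hxS (Set.mem_iUnion.2 ⟨n, hx, hn⟩)
  choose u hu hxu using hu
  have hlim : Filter.Tendsto u Filter.atTop (nhds x) := by
    refine tendsto_of_tendsto_of_tendsto_of_le_of_le ?_ tendsto_const_nhds
      (fun n => (hu n).1.le) (fun n => (hu n).2.le)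
    simpa using tendsto_one_div_add_atTop_nhds_zero_nat.const_sub x
  obtain ⟨y, hy⟩ := hg x u hxu
  exact not_mapClusterPt_hTopology_of_lt hx hlim (fun n => (hu n).2) y hy

theorem theoremt111 (A : Set ℝ) :
    List.TFAE [@TopologicalSpace.MetrizableSpace ℝ (hTopology A),
      IsBetaSpace ℝ (hTopology A),
      Aᶜ.Countable] := by
  tfae_have 1 → 2 := fun _ => isBetaSpace_of_metrizableSpace (hTopology A)
  tfae_have 2 → 3 := countable_compl_of_isBetaSpace
  tfae_have 3 → 1 := by
    intro hA
    let _ : TopologicalSpace ℝ := hTopology A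
    have := t2Space_hTopology A
    have := regularSpace_hTopology A
    have := secondCountableTopology_hTopology hA
    exact TopologicalSpace.metrizableSpace_of_t3_secondCountable ℝ
  tfae_finish
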